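/- Let $\alpha=\frac{1+i\sqrt3}{2}$ and, for $t>0$ and $s\in\mathbb{C}$, let $t^{s}=e^{s\ln t}$ with $\ln t$ the real logarithm. Then the following three integrals converge absolutely, and $$\int_0^\infty\frac{dt}{(1+t+t^{\alpha})^2}=\frac23,\qquad \int_0^\infty\frac{t^{\alpha}\,dt}{(1+t+t^{\alpha})^2}=\frac{\alpha}{3},\qquad \int_0^\infty\frac{t^{\alpha-1}\,dt}{(1+t+t^{\alpha})^2}=\frac{1}{3\alpha}.$$ -/

import Mathlib

/-!
The numbers `0`, `1`, `α` are the vertices of an equilateral triangle, and the proof rests on the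
resulting threefold symmetry of the denominator. Put `k_c(u) = e^{-cu} / (1 + e^{-u} + e^{-αu})²` and
`K_c = ∫_0^∞ k_c(x) dx`. With `t = e^x`, the part `0 < t < 1` of the integral of
`t^s / (1 + t + t^α)²` is `K_{1+s}`, while the part `t > 1` is the integral over `x > 0` of
`e^{-(1-s)x} / (1 + e^{-x} + e^{-(1-α)x})²`. Turning the path of the latter to the ray through
`α = e^{iπ/3}` and using `α (1 - α) = 1` transforms its denominator into that of `k_c`, so that the
whole integral equals `α K_{(1-s)α} + K_{1+s}` (`integrableOn_and_integral_cpow_div`). For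
`s = 0, α, α - 1` only the three numbers `K_1`, `K_α`, `K_{1+α}` occur. Integrating the derivatives of
`e^{-px} / (1 + e^{-x} + e^{-αx})` for `p = 0, 1, α` (`expKernel_integral_relation`) yields
`K_1 + α K_α = 2/3`, `K_1 + (1 - α) K_{1+α} = 1/3` and `α K_α - (1 - α) K_{1+α} = 1/3`, and these
relations determine the three combinations.

Turning the path (`integral_Ioi_eq_mul_integral_Ioi_of_sector`) is an exchange of two integrations
over the sector, and is legitimate because the denominator stays away from `0` there
(`le_norm_sector_denominator`).
-/

open MeasureTheory Set Filter Topology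

/-! ### Lower bound for the denominator in the sector -/

/-- For `x + iy` in the sector `|y| ≤ √3 x`, the real part of `e^{-(x + iy)}` is negative only if
`|y| > π/2`, and then `x > 0.9`. The value `9/20 < 1/2` leaves room for two such terms
next to `1`. -/
lemma neg_le_exp_neg_mul_cos {x y : ℝ} (h : |y| ≤ √3 * x) :
    -(9 / 20) ≤ Real.exp (-x) * Real.cos y := by
  have h3 : √3 < 1.74 := by
    rw [Real.sqrt_lt' (by norm_num)]; norm_num
  have h3' : 0 < √3 := by positivity
  have hx : 0 ≤ x := by
    by_contra hx
    have := abs_nonneg y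
    nlinarith
  by_cases hy : |y| ≤ Real.pi / 2
  · have := Real.cos_nonneg_of_mem_Icc (abs_le.mp hy)
    have := mul_nonneg (Real.exp_pos (-x)).le this
    linarith
  · have hx' : 0.9 ≤ x := by
      have := Real.pi_gt_d2
      nlinarith
    have he : Real.exp (-x) ≤ 9 / 20 := by
      have := Real.quadratic_le_exp_of_nonneg hx
      rw [Real.exp_neg]
      have h2 : (20 / 9 : ℝ) ≤ Real.exp x := by nlinarith
      have := inv_anti₀ (by norm_num) h2
      linarith
    have := Real.neg_one_le_cos y
    nlinarith [Real.exp_pos (-x)]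

/-- The closed sector spanned by `1` and `α = e^{iπ/3}` is `x + yα` with `x, y ≥ 0`. There both
`u` and `(1 - α) u` have argument of absolute value at most `π/3`. -/
lemma le_norm_sector_denominator {α : ℂ} (hre : α.re = 1 / 2) (him : α.im = √3 / 2)
    {x y : ℝ} (hx : 0 ≤ x) (hy : 0 ≤ y) :
    1 / 10 ≤ ‖1 + Complex.exp (-(x + y * α)) + Complex.exp (-((1 - α) * (x + y * α)))‖ := by
  refine le_trans ?_ (Complex.re_le_norm _)
  have h3 : √3 * √3 = 3 := Real.mul_self_sqrt (by norm_num)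
  have h3' : 0 < √3 := by positivity
  have h1 : |-(y * (√3 / 2))| ≤ √3 * (x + y / 2) := by
    rw [abs_neg, abs_of_nonneg (by positivity)]
    nlinarith [mul_nonneg h3'.le hx]
  have h2 : |x * (√3 / 2)| ≤ √3 * (x / 2 + y) := by
    rw [abs_of_nonneg (by positivity)]
    nlinarith [mul_nonneg h3'.le hy]
  have e1 := neg_le_exp_neg_mul_cos h1
  have e2 := neg_le_exp_neg_mul_cos h2
  have r1 : (-((x : ℂ) + y * α)).re = -(x + y / 2) := by simp [hre]; ring
  have i1 : (-((x : ℂ) + y * α)).im = -(y * (√3 / 2)) := by simp [him]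
  have r2 : (-((1 - α) * ((x : ℂ) + y * α))).re = -(x / 2 + y) := by
    simp [hre, him]; linear_combination (-(y / 4)) * h3
  have i2 : (-((1 - α) * ((x : ℂ) + y * α))).im = x * (√3 / 2) := by
    simp [hre, him]; ring
  rw [Complex.add_re, Complex.add_re, Complex.exp_re, Complex.exp_re, r1, i1, r2, i2,
    Complex.one_re]
  linarith

/-! ### Rotating a path of integration -/

lemma tendsto_zero_of_norm_le_exp {g : ℝ → ℂ} {C c : ℝ} (hc : 0 < c)
    (hg : ∀ x, 0 ≤ x → ‖g x‖ ≤ C * Real.exp (-(c * x))) : Tendsto g atTop (𝓝 0) := by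
  refine squeeze_zero_norm' ((eventually_ge_atTop 0).mono hg) ?_
  have : Tendsto (fun x : ℝ => Real.exp (-(c * x))) atTop (𝓝 0) :=
    Real.tendsto_exp_neg_atTop_nhds_zero.comp (tendsto_id.const_mul_atTop hc)
  simpa using this.const_mul C

lemma integrableOn_Ioi_of_norm_le_exp {g : ℝ → ℂ} {C c : ℝ} (hc : 0 < c) (hm : Measurable g)
    (hg : ∀ x, 0 ≤ x → ‖g x‖ ≤ C * Real.exp (-(c * x))) : IntegrableOn g (Ioi 0) := by
  refine ((exp_neg_integrableOn_Ioi 0 hc).const_mul C).mono' hm.aestronglyMeasurable ?_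
  refine (ae_restrict_iff' measurableSet_Ioi).2 (ae_of_all _ fun x hx => ?_)
  simpa using hg x (le_of_lt hx)

lemma integral_Ioi_deriv_along_ray {f f' : ℂ → ℂ} {p d : ℂ} {C c : ℝ} (hc : 0 < c)
    (hf' : Measurable f')
    (hd : ∀ t : ℝ, 0 ≤ t → HasDerivAt f (f' (p + t * d)) (p + t * d))
    (hb : ∀ t : ℝ, 0 ≤ t → ‖f (p + t * d)‖ ≤ C * Real.exp (-(c * t)))
    (hb' : ∀ t : ℝ, 0 ≤ t → ‖f' (p + t * d)‖ ≤ C * Real.exp (-(c * t))) :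
    ∫ t : ℝ in Ioi 0, d * f' (p + t * d) = -f p := by
  have := integral_Ioi_of_hasDerivAt_of_tendsto' (a := 0) (m := 0)
    (f := fun t : ℝ => f (p + t * d)) (f' := fun t : ℝ => d * f' (p + t * d)) ?_ ?_ ?_
  · simpa using this
  · intro t ht
    have h1 : HasDerivAt (fun t : ℝ => p + (t : ℂ) * d) d t := by
      simpa using ((Complex.ofRealCLM.hasDerivAt (x := t)).mul_const d).const_add p
    have h2 := (hd t ht).comp t h1
    rw [mul_comm] at h2
    exact h2
  · exact (integrableOn_Ioi_of_norm_le_exp hc (by fun_prop) hb').const_mul d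
  · exact tendsto_zero_of_norm_le_exp hc hb

/-- Rotation of a ray without Cauchy's theorem: for `f` decaying exponentially in the closed sector
spanned by `1` and `α`, both sides equal `-∫∫ α f'(x + yα) dx dy` over the quadrant `x, y > 0`. -/
lemma integral_Ioi_eq_mul_integral_Ioi_of_sector {f f' : ℂ → ℂ} (α : ℂ) {C c : ℝ} (hc : 0 < c)
    (hf' : Measurable f')
    (hd : ∀ x y : ℝ, 0 ≤ x → 0 ≤ y → HasDerivAt f (f' (x + y * α)) (x + y * α))
    (hb : ∀ x y : ℝ, 0 ≤ x → 0 ≤ y → ‖f (x + y * α)‖ ≤ C * Real.exp (-(c * (x + y))))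
    (hb' : ∀ x y : ℝ, 0 ≤ x → 0 ≤ y → ‖f' (x + y * α)‖ ≤ C * Real.exp (-(c * (x + y)))) :
    ∫ x : ℝ in Ioi 0, f x = α * ∫ y : ℝ in Ioi 0, f (y * α) := by
  have hexp : IntegrableOn (fun x : ℝ => Real.exp (-c * x)) (Ioi 0) :=
    exp_neg_integrableOn_Ioi 0 hc
  have hC : 0 ≤ C := by simpa using (norm_nonneg _).trans (hb 0 0 le_rfl le_rfl)
  have hint : Integrable (Function.uncurry fun x y : ℝ => α * f' (x + y * α))
      ((volume.restrict (Ioi 0)).prod (volume.restrict (Ioi 0))) := by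
    refine (((hexp.mul_prod hexp).const_mul (‖α‖ * C))).mono' ?_ ?_
    · exact Measurable.aestronglyMeasurable (by unfold Function.uncurry; fun_prop)
    · rw [Measure.prod_restrict]
      refine (ae_restrict_iff' (measurableSet_Ioi.prod measurableSet_Ioi)).2
        (ae_of_all _ fun p hp => ?_)
      obtain ⟨h1, h2⟩ := hp
      simp only [mem_Ioi] at h1 h2
      simp only [Function.uncurry, norm_mul]
      rw [← Real.exp_add, mul_assoc]
      refine mul_le_mul_of_nonneg_left ((hb' _ _ h1.le h2.le).trans (le_of_eq ?_)) (norm_nonneg _)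
      ring_nf
  have hleft : ∀ x y : ℝ, 0 ≤ x → C * Real.exp (-(c * (x + y))) ≤ C * Real.exp (-(c * y)) := by
    intro x y hx
    gcongr
    linarith
  have hright : ∀ x y : ℝ, 0 ≤ y → C * Real.exp (-(c * (x + y))) ≤ C * Real.exp (-(c * x)) := by
    intro x y hy
    gcongr
    linarith
  have hx : ∀ x ∈ Ioi (0 : ℝ), ∫ y : ℝ in Ioi 0, α * f' (x + y * α) = -f x := fun x hx =>
    integral_Ioi_deriv_along_ray hc hf' (fun y hy => hd x y (le_of_lt hx) hy)
      (fun y hy => (hb x y (le_of_lt hx) hy).trans (hleft x y (le_of_lt hx)))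
      (fun y hy => (hb' x y (le_of_lt hx) hy).trans (hleft x y (le_of_lt hx)))
  have hy : ∀ y ∈ Ioi (0 : ℝ), ∫ x : ℝ in Ioi 0, α * f' (x + y * α) = -(α * f (y * α)) := by
    intro y hy
    have hy0 : (0 : ℝ) ≤ y := le_of_lt hy
    have := integral_Ioi_deriv_along_ray (f := f) (f' := f') (p := y * α) (d := 1) (C := C) hc hf'
      ?_ ?_ ?_
    · simp only [mul_one, one_mul, add_comm ((y : ℂ) * α)] at this
      rw [integral_const_mul, this, mul_neg]
    all_goals intro x hx0; rw [mul_one, add_comm ((y : ℂ) * α)]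
    · exact hd x y hx0 hy0
    · exact (hb x y hx0 hy0).trans (hright x y hy0)
    · exact (hb' x y hx0 hy0).trans (hright x y hy0)
  have := integral_integral_swap hint
  rw [setIntegral_congr_fun measurableSet_Ioi hx, setIntegral_congr_fun measurableSet_Ioi hy,
    integral_neg, integral_neg, integral_const_mul] at this
  exact neg_injective this

/-! ### The exponential kernels -/

/-- The function `e^{-cu} / (1 + e^{-u} + e^{-βu})²`. -/
noncomputable def expKernel (β c u : ℂ) : ℂ :=
  Complex.exp (-(c * u)) / (1 + Complex.exp (-u) + Complex.exp (-(β * u))) ^ 2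

lemma measurable_expKernel (β c : ℂ) : Measurable (expKernel β c) := by
  unfold expKernel
  fun_prop

lemma integrableOn_expKernel {β c : ℂ} (hc : 1 / 2 ≤ c.re)
    (hden : ∀ x : ℝ, 0 ≤ x →
      1 / 10 ≤ ‖1 + Complex.exp (-x) + Complex.exp (-(β * x))‖) :
    IntegrableOn (fun x : ℝ => expKernel β c x) (Ioi 0) := by
  refine integrableOn_Ioi_of_norm_le_exp (C := 100) (c := 1 / 2) (by norm_num)
    ((measurable_expKernel β c).comp Complex.measurable_ofReal) fun x hx => ?_
  rw [expKernel, norm_div, norm_pow, Complex.norm_exp]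
  rw [div_le_iff₀ (by have := hden x hx; positivity)]
  have h1 : Real.exp (-(c * (x : ℂ))).re ≤ Real.exp (-(1 / 2 * x)) := by
    apply Real.exp_le_exp.2
    simp only [Complex.neg_re, Complex.re_mul_ofReal]
    nlinarith
  have h2 : 1 ≤ 100 * ‖1 + Complex.exp (-(x : ℂ)) + Complex.exp (-(β * x))‖ ^ 2 := by
    nlinarith [hden x hx]
  nlinarith [Real.exp_pos (-(1 / 2 * x))]

/-- The integral of `expKernel (1 - α) b` along the positive axis may be moved to the ray through
`α`, on which the kernel becomes `expKernel α (b * α)` because `α (1 - α) = 1`. -/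
lemma integral_expKernel_rotate {α b : ℂ} (hre : α.re = 1 / 2) (him : α.im = √3 / 2)
    (hb : 1 / 2 ≤ b.re) (hbα : 1 / 2 ≤ (b * α).re) (hα : α * (1 - α) = 1) :
    ∫ x : ℝ in Ioi 0, expKernel (1 - α) b x =
      α * ∫ x : ℝ in Ioi 0, expKernel α (b * α) x := by
  set H : ℂ → ℂ := fun u => 1 + Complex.exp (-u) + Complex.exp (-((1 - α) * u)) with hH
  have hden : ∀ x y : ℝ, 0 ≤ x → 0 ≤ y → 1 / 10 ≤ ‖H (x + y * α)‖ := fun x y hx hy =>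
    le_norm_sector_denominator hre him hx hy
  have hinv : ∀ x y : ℝ, 0 ≤ x → 0 ≤ y → ‖(H (x + y * α))⁻¹‖ ≤ 10 := by
    intro x y hx hy
    rw [norm_inv]
    have := inv_anti₀ (by norm_num) (hden x y hx hy)
    linarith
  have hnum : ∀ x y : ℝ, 0 ≤ x → 0 ≤ y →
      ‖Complex.exp (-(b * (x + y * α)))‖ ≤ Real.exp (-(1 / 2 * (x + y))) := by
    intro x y hx hy
    rw [Complex.norm_exp, Real.exp_le_exp]
    have : (-(b * ((x : ℂ) + y * α))).re = -(b.re * x + (b * α).re * y) := by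
      simp; ring
    rw [this]
    nlinarith
  have hexp : ∀ z : ℂ, 0 ≤ z.re → ‖Complex.exp (-z)‖ ≤ 1 := by
    intro z hz
    rw [Complex.norm_exp, Real.exp_le_one_iff]
    simpa using hz
  have h3 : √3 * √3 = 3 := Real.mul_self_sqrt (by norm_num)
  have hz1 : ∀ x y : ℝ, 0 ≤ x → 0 ≤ y → 0 ≤ ((x : ℂ) + y * α).re := by
    intro x y hx hy
    simp [hre]; positivity
  have hz2 : ∀ x y : ℝ, 0 ≤ x → 0 ≤ y → 0 ≤ ((1 - α) * ((x : ℂ) + y * α)).re := by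
    intro x y hx hy
    have : ((1 - α) * ((x : ℂ) + y * α)).re = x / 2 + y := by
      simp [hre, him]; linear_combination (y / 4) * h3
    rw [this]; positivity
  -- `‖H⁻¹‖ ≤ 10` accounts for `100 = 10²` and `2000 = 2 · 10³` in `C`.
  have key := integral_Ioi_eq_mul_integral_Ioi_of_sector (f := expKernel (1 - α) b)
    (f' := fun u => -b * (Complex.exp (-(b * u)) * (H u)⁻¹ ^ 2) + 2 * Complex.exp (-(b * u)) *
      (Complex.exp (-u) + (1 - α) * Complex.exp (-((1 - α) * u))) * (H u)⁻¹ ^ 3) α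
    (C := 100 * (1 + ‖b‖) + 2000 * (1 + ‖1 - α‖)) (c := 1 / 2) (by norm_num)
    (by fun_prop) ?_ ?_ ?_
  · rw [key]
    congr 1
    refine setIntegral_congr_fun measurableSet_Ioi fun y _ => ?_
    have e : (1 - α) * ((y : ℂ) * α) = y := by linear_combination (y : ℂ) * hα
    simp only [expKernel, e]
    ring_nf
  · intro x y hx hy
    have h0 : H (x + y * α) ≠ 0 := norm_pos_iff.1 (lt_of_lt_of_le (by norm_num) (hden x y hx hy))
    have hE : ∀ (c u : ℂ), HasDerivAt (fun u => Complex.exp (-(c * u)))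
        (-c * Complex.exp (-(c * u))) u := by
      intro c u
      simpa [mul_comm] using (((hasDerivAt_id u).const_mul c).neg).cexp
    have hE1 : ∀ u : ℂ, HasDerivAt (fun u => Complex.exp (-u)) (-Complex.exp (-u)) u := by
      intro u
      simpa using hE 1 u
    have hd := (hE b (x + y * α)).div
      ((((hE1 (x + y * α)).const_add 1).add (hE (1 - α) (x + y * α))).pow 2) (pow_ne_zero 2 h0)
    refine hd.congr_deriv ?_
    change (_ * H (x + y * α) ^ 2 - _ * (_ * H (x + y * α) ^ _ * _)) / (H (x + y * α) ^ 2) ^ 2 = _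
    field_simp
    ring
  · intro x y hx hy
    have e : expKernel (1 - α) b (x + y * α)
        = Complex.exp (-(b * (x + y * α))) * (H (x + y * α))⁻¹ ^ 2 := by
      rw [inv_pow, ← div_eq_mul_inv]; rfl
    rw [e, norm_mul, norm_pow]
    calc _ ≤ Real.exp (-(1 / 2 * (x + y))) * 10 ^ 2 := by
          gcongr
          exacts [hnum x y hx hy, hinv x y hx hy]
      _ ≤ _ := by
          rw [mul_comm]
          gcongr
          nlinarith [norm_nonneg b, norm_nonneg (1 - α)]
  · intro x y hx hy
    have t1 : ‖-b * (Complex.exp (-(b * (x + y * α))) * (H (x + y * α))⁻¹ ^ 2)‖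
        ≤ ‖b‖ * (Real.exp (-(1 / 2 * (x + y))) * 10 ^ 2) := by
      rw [norm_mul, norm_mul, norm_pow, norm_neg]
      gcongr
      exacts [hnum x y hx hy, hinv x y hx hy]
    have t2 : ‖Complex.exp (-(x + y * α)) + (1 - α) * Complex.exp (-((1 - α) * (x + y * α)))‖
        ≤ 1 + ‖1 - α‖ * 1 := by
      refine (norm_add_le _ _).trans ?_
      rw [norm_mul]
      gcongr
      exacts [hexp _ (hz1 x y hx hy), hexp _ (hz2 x y hx hy)]
    have t3 : ‖2 * Complex.exp (-(b * (x + y * α))) *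
        (Complex.exp (-(x + y * α)) + (1 - α) * Complex.exp (-((1 - α) * (x + y * α)))) *
          (H (x + y * α))⁻¹ ^ 3‖
        ≤ 2 * Real.exp (-(1 / 2 * (x + y))) * (1 + ‖1 - α‖ * 1) * 10 ^ 3 := by
      rw [norm_mul, norm_mul, norm_mul, norm_pow, Complex.norm_ofNat]
      gcongr
      exacts [hnum x y hx hy, hinv x y hx hy]
    refine (norm_add_le _ _).trans ((add_le_add t1 t3).trans ?_)
    nlinarith [Real.exp_pos (-(1 / 2 * (x + y)))]

/-- On the ray through `α` the bound of `le_norm_sector_denominator` concerns the denominator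
`1 + e^{-x} + e^{-αx}`, since `(1 - α) α = 1`. -/
lemma norm_denominator_on_ray {α : ℂ} (hre : α.re = 1 / 2) (him : α.im = √3 / 2)
    (hα : α * (1 - α) = 1) (x : ℝ) (hx : 0 ≤ x) :
    1 / 10 ≤ ‖1 + Complex.exp (-x) + Complex.exp (-(α * x))‖ := by
  have h := le_norm_sector_denominator hre him le_rfl hx
  have e : (1 - α) * ((x : ℂ) * α) = x := by linear_combination (x : ℂ) * hα
  rw [Complex.ofReal_zero, zero_add, e] at h
  simpa [mul_comm α, add_right_comm] using h

/-- Integrating the derivative of `e^{-px} / (1 + e^{-x} + e^{-αx})`, which is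
`-p k_p + (1 - p) k_{p+1} + (α - p) k_{p+α}` with `k_c = expKernel α c`; in the cases of interest one
of the three coefficients vanishes and two kernels remain. -/
lemma expKernel_integral_relation {α p A B c₁ c₂ m : ℂ} (hre : α.re = 1 / 2)
    (hden : ∀ x : ℝ, 0 ≤ x → 1 / 10 ≤ ‖1 + Complex.exp (-x) + Complex.exp (-(α * x))‖)
    (h₁ : 1 / 2 ≤ c₁.re) (h₂ : 1 / 2 ≤ c₂.re)
    (hk : ∀ u, -p * expKernel α p u + (1 - p) * expKernel α (p + 1) u +
      (α - p) * expKernel α (p + α) u = A * expKernel α c₁ u + B * expKernel α c₂ u)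
    (hm : Tendsto (fun x : ℝ => Complex.exp (-(p * x))) atTop (𝓝 m)) :
    A * (∫ x : ℝ in Ioi 0, expKernel α c₁ x) + B * (∫ x : ℝ in Ioi 0, expKernel α c₂ x) =
      m - 1 / 3 := by
  have i₁ := (integrableOn_expKernel h₁ hden).const_mul A
  have i₂ := (integrableOn_expKernel h₂ hden).const_mul B
  have hE : ∀ (c : ℂ) (x : ℝ), HasDerivAt (fun x : ℝ => Complex.exp (-(c * x)))
      (-c * Complex.exp (-(c * x))) x := by
    intro c x
    simpa [mul_comm] using ((((hasDerivAt_id (x : ℂ)).const_mul c).neg).cexp).comp_ofReal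
  have hE1 : ∀ x : ℝ, HasDerivAt (fun x : ℝ => Complex.exp (-(x : ℂ))) (-Complex.exp (-x)) x := by
    intro x
    simpa using hE 1 x
  have key := integral_Ioi_of_hasDerivAt_of_tendsto' (a := 0) (m := m)
    (f := fun x : ℝ => Complex.exp (-(p * x)) /
      (1 + Complex.exp (-x) + Complex.exp (-(α * x))))
    (f' := fun x : ℝ => A * expKernel α c₁ x + B * expKernel α c₂ x) ?_ (i₁.add i₂) ?_
  · rw [integral_add i₁ i₂, integral_const_mul, integral_const_mul] at key
    rw [key]
    norm_num
  · intro x hx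
    have h0 : 1 + Complex.exp (-x) + Complex.exp (-(α * x)) ≠ 0 :=
      norm_pos_iff.1 (lt_of_lt_of_le (by norm_num) (hden x hx))
    have hd := (hE p x).div (((hE1 x).const_add 1).add (hE α x)) h0
    refine hd.congr_deriv ?_
    rw [← hk]
    have e1 : Complex.exp (-((p + 1) * x)) = Complex.exp (-(p * x)) * Complex.exp (-x) := by
      rw [← Complex.exp_add]; ring_nf
    have e2 : Complex.exp (-((p + α) * x)) = Complex.exp (-(p * x)) * Complex.exp (-(α * x)) := by
      rw [← Complex.exp_add]; ring_nf
    simp only [expKernel, e1, e2, Pi.add_apply]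
    field_simp
    ring
  · have t1 : Tendsto (fun x : ℝ => Complex.exp (-(x : ℂ))) atTop (𝓝 0) :=
      tendsto_zero_of_norm_le_exp (C := 1) (c := 1) one_pos fun x _ => by
        rw [Complex.norm_exp]; simp
    have t2 : Tendsto (fun x : ℝ => Complex.exp (-(α * x))) atTop (𝓝 0) :=
      tendsto_zero_of_norm_le_exp (C := 1) (c := 1 / 2) (by norm_num) fun x _ => by
        rw [Complex.norm_exp]; simp [hre]
    have t3 := hm.div ((t1.const_add 1).add t2) (by simp)
    simp only [add_zero, div_one] at t3
    exact t3

/-! ### The substitution `t = e^x` -/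

/-- The substitution `t = e^x`, with the half-line split at `t = 1`. -/
lemma integrableOn_and_integral_Ioi_eq_exp_split {g : ℝ → ℂ}
    (hpos : IntegrableOn (fun x : ℝ => Real.exp x • g (Real.exp x)) (Ioi 0))
    (hneg : IntegrableOn (fun x : ℝ => Real.exp (-x) • g (Real.exp (-x))) (Ioi 0)) :
    IntegrableOn g (Ioi 0) ∧ ∫ t in Ioi 0, g t =
      (∫ x in Ioi 0, Real.exp x • g (Real.exp x)) +
        ∫ x in Ioi 0, Real.exp (-x) • g (Real.exp (-x)) := by
  have im1 : Real.exp '' Ioi 0 = Ioi 1 := by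
    ext t
    simp only [mem_image, mem_Ioi]
    constructor
    · rintro ⟨x, hx, rfl⟩
      exact Real.one_lt_exp_iff.2 hx
    · intro ht
      exact ⟨Real.log t, Real.log_pos ht, Real.exp_log (by linarith)⟩
  have im2 : (fun x => Real.exp (-x)) '' Ioi 0 = Ioo 0 1 := by
    ext t
    simp only [mem_image, mem_Ioi, mem_Ioo]
    constructor
    · rintro ⟨x, hx, rfl⟩
      exact ⟨Real.exp_pos _, by rw [← Real.exp_zero]; exact Real.exp_lt_exp.2 (by linarith)⟩
    · rintro ⟨h0, h1⟩
      exact ⟨-Real.log t, by have := Real.log_neg h0 h1; linarith, by simp [Real.exp_log h0]⟩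
  have d1 : ∀ x ∈ Ioi (0 : ℝ), HasDerivWithinAt Real.exp (Real.exp x) (Ioi 0) x := fun x _ =>
    (Real.hasDerivAt_exp x).hasDerivWithinAt
  have d2 : ∀ x ∈ Ioi (0 : ℝ),
      HasDerivWithinAt (fun x => Real.exp (-x)) (-Real.exp (-x)) (Ioi 0) x := fun x _ => by
    simpa using ((hasDerivAt_id x).neg.exp).hasDerivWithinAt
  have j1 : InjOn Real.exp (Ioi 0) := Real.exp_injective.injOn
  have j2 : InjOn (fun x => Real.exp (-x)) (Ioi 0) :=
    (Real.exp_injective.comp neg_injective).injOn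
  have I1 := integrableOn_image_iff_integrableOn_abs_deriv_smul measurableSet_Ioi d1 j1 g
  have I2 := integrableOn_image_iff_integrableOn_abs_deriv_smul measurableSet_Ioi d2 j2 g
  have E1 := integral_image_eq_integral_abs_deriv_smul measurableSet_Ioi d1 j1 g
  have E2 := integral_image_eq_integral_abs_deriv_smul measurableSet_Ioi d2 j2 g
  simp only [abs_neg, Real.abs_exp, im1, im2] at I1 I2 E1 E2
  have G1 := I1.2 hpos
  have G2 : IntegrableOn g (Ioc 0 1) := (I2.2 hneg).congr_set_ae Ioo_ae_eq_Ioc.symm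
  have hu : Ioi (0 : ℝ) = Ioc 0 1 ∪ Ioi 1 := (Ioc_union_Ioi_eq_Ioi zero_le_one).symm
  refine ⟨hu ▸ G2.union G1, ?_⟩
  rw [← E1, ← E2, hu, setIntegral_union (Ioc_disjoint_Ioi le_rfl) measurableSet_Ioi G2 G1,
    integral_Ioc_eq_integral_Ioo, add_comm]

/-- In the variable `x = ln t` the integrand `t^s / (1 + t + t^α)²` is an `expKernel` on either side
of `0`; the positive half is then rotated so that both halves use the same kernel. -/
lemma integrableOn_and_integral_cpow_div {α s : ℂ} (hre : α.re = 1 / 2) (him : α.im = √3 / 2)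
    (hα : α * (1 - α) = 1) (h₁ : 1 / 2 ≤ (1 - s).re) (h₂ : 1 / 2 ≤ ((1 - s) * α).re)
    (h₃ : 1 / 2 ≤ (1 + s).re) :
    IntegrableOn (fun t : ℝ => (t : ℂ) ^ s / (1 + (t : ℂ) + (t : ℂ) ^ α) ^ 2) (Ioi 0) ∧
      ∫ t : ℝ in Ioi 0, (t : ℂ) ^ s / (1 + (t : ℂ) + (t : ℂ) ^ α) ^ 2 =
        α * (∫ x : ℝ in Ioi 0, expKernel α ((1 - s) * α) x) +
          ∫ x : ℝ in Ioi 0, expKernel α (1 + s) x := by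
  have hpow : ∀ (x : ℝ) (c : ℂ), ((Real.exp x : ℝ) : ℂ) ^ c = Complex.exp (c * x) := by
    intro x c
    rw [Complex.cpow_def_of_ne_zero (by exact_mod_cast (Real.exp_pos x).ne'),
      ← Complex.ofReal_log (Real.exp_pos x).le, Real.log_exp, mul_comm]
  have e1 : ∀ x : ℝ, Real.exp x • (((Real.exp x : ℝ) : ℂ) ^ s /
      (1 + ((Real.exp x : ℝ) : ℂ) + ((Real.exp x : ℝ) : ℂ) ^ α) ^ 2) =
      expKernel (1 - α) (1 - s) x := by
    intro x
    rw [hpow, hpow, Complex.real_smul, Complex.ofReal_exp, expKernel]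
    have a1 : Complex.exp (-((1 - s) * x)) = Complex.exp (s * x) * Complex.exp (-x) := by
      rw [← Complex.exp_add]; ring_nf
    have a2 : Complex.exp (-((1 - α) * x)) = Complex.exp (α * x) * Complex.exp (-x) := by
      rw [← Complex.exp_add]; ring_nf
    have hx := Complex.exp_ne_zero (x : ℂ)
    have a3 : 1 + Complex.exp (-x) + Complex.exp (α * x) * Complex.exp (-x) =
        (1 + Complex.exp x + Complex.exp (α * x)) * Complex.exp (-x) := by
      rw [Complex.exp_neg]; field_simp; ring
    rw [a1, a2, a3, mul_pow, Complex.exp_neg]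
    field_simp
  have e2 : ∀ x : ℝ, Real.exp (-x) • (((Real.exp (-x) : ℝ) : ℂ) ^ s /
      (1 + ((Real.exp (-x) : ℝ) : ℂ) + ((Real.exp (-x) : ℝ) : ℂ) ^ α) ^ 2) =
      expKernel α (1 + s) x := by
    intro x
    rw [hpow, hpow, Complex.real_smul, Complex.ofReal_exp, expKernel]
    have a1 : Complex.exp (-((1 + s) * x)) = Complex.exp (-x) * Complex.exp (-(s * x)) := by
      rw [← Complex.exp_add]; ring_nf
    rw [a1]
    push_cast
    simp only [mul_neg]
    ring
  have k1 := integrableOn_expKernel (β := 1 - α) h₁ fun x hx => by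
    simpa using le_norm_sector_denominator hre him hx le_rfl
  have k2 := integrableOn_expKernel (β := α) h₃ (norm_denominator_on_ray hre him hα)
  have := integrableOn_and_integral_Ioi_eq_exp_split
    (g := fun t : ℝ => (t : ℂ) ^ s / (1 + (t : ℂ) + (t : ℂ) ^ α) ^ 2)
    (by simpa only [e1] using k1) (by simpa only [e2] using k2)
  simp only [e2] at this
  simp only [e1, integral_expKernel_rotate hre him h₁ h₂ hα] at this
  exact this

/-! ### Evaluation of the three integrals -/

theorem mainTheorem11 (α : ℂ) (hα : α = (1 + Complex.I * (Real.sqrt 3 : ℂ)) / 2) :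
    (MeasureTheory.IntegrableOn
        (fun t : ℝ => 1 / (1 + (t : ℂ) + (t : ℂ) ^ α) ^ 2) (Set.Ioi 0) ∧
      ∫ t : ℝ in Set.Ioi 0, 1 / (1 + (t : ℂ) + (t : ℂ) ^ α) ^ 2 = 2 / 3) ∧
    (MeasureTheory.IntegrableOn
        (fun t : ℝ => (t : ℂ) ^ α / (1 + (t : ℂ) + (t : ℂ) ^ α) ^ 2) (Set.Ioi 0) ∧
      ∫ t : ℝ in Set.Ioi 0, (t : ℂ) ^ α / (1 + (t : ℂ) + (t : ℂ) ^ α) ^ 2 = α / 3) ∧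
    (MeasureTheory.IntegrableOn
        (fun t : ℝ => (t : ℂ) ^ (α - 1) / (1 + (t : ℂ) + (t : ℂ) ^ α) ^ 2) (Set.Ioi 0) ∧
      ∫ t : ℝ in Set.Ioi 0, (t : ℂ) ^ (α - 1) / (1 + (t : ℂ) + (t : ℂ) ^ α) ^ 2
        = 1 / (3 * α)) := by
  have h3 : √3 * √3 = 3 := Real.mul_self_sqrt (by norm_num)
  have hre : α.re = 1 / 2 := by rw [hα]; simp
  have him : α.im = √3 / 2 := by rw [hα]; simp
  have hmul : α * (1 - α) = 1 := by
    apply Complex.ext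
    · simp [hre, him]; linear_combination h3 / 4
    · simp [hre, him]; ring
  have hα0 : α ≠ 0 := left_ne_zero_of_mul_eq_one hmul
  have hden := norm_denominator_on_ray hre him hmul
  have tE : ∀ p : ℂ, 1 / 2 ≤ p.re →
      Tendsto (fun x : ℝ => Complex.exp (-(p * x))) atTop (𝓝 0) := fun p hp =>
    tendsto_zero_of_norm_le_exp (C := 1) (c := 1 / 2) (by norm_num) fun x hx => by
      rw [Complex.norm_exp, one_mul, Real.exp_le_exp]
      simp only [Complex.neg_re, Complex.re_mul_ofReal]
      nlinarith
  have r0 := expKernel_integral_relation (p := 0) (A := 1) (B := α) (c₁ := 1) (c₂ := α) (m := 1)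
    hre hden (by norm_num) hre.ge (fun u => by simp) (by simp)
  have r1 := expKernel_integral_relation (p := 1) (A := -1) (B := α - 1) (c₁ := 1) (c₂ := 1 + α)
    (m := 0) hre hden (by norm_num) (by simp [hre]) (fun u => by simp)
    (tE 1 (by norm_num))
  have r2 := expKernel_integral_relation (p := α) (A := -α) (B := 1 - α) (c₁ := α) (c₂ := 1 + α)
    (m := 0) hre hden hre.ge (by simp [hre]) (fun u => by rw [add_comm α 1]; simp)
    (tE α hre.ge)
  set K1 := ∫ x : ℝ in Ioi 0, expKernel α 1 x
  set Kα := ∫ x : ℝ in Ioi 0, expKernel α α x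
  set Ks := ∫ x : ℝ in Ioi 0, expKernel α (1 + α) x
  have m1 := integrableOn_and_integral_cpow_div (s := 0) hre him hmul (by norm_num)
    (by simp [hre]) (by norm_num)
  have m2 := integrableOn_and_integral_cpow_div (s := α) hre him hmul
    (by simp [hre]; norm_num) (by rw [mul_comm, hmul]; norm_num) (by simp [hre])
  have c3 : (1 - (α - 1)) * α = 1 + α := by linear_combination hmul
  have m3 := integrableOn_and_integral_cpow_div (s := α - 1) hre him hmul
    (by simp [hre]; norm_num) (by rw [c3]; simp [hre]) (by simp [hre])
  rw [c3, show 1 + (α - 1) = α by ring] at m3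
  rw [mul_comm (1 - α), hmul] at m2
  simp only [Complex.cpow_zero, sub_zero, one_mul, add_zero] at m1
  refine ⟨⟨m1.1, m1.2.trans ?_⟩, ⟨m2.1, m2.2.trans ?_⟩, ⟨m3.1, m3.2.trans ?_⟩⟩
  · linear_combination r0
  · linear_combination (-α) * r1 - Ks * hmul
  · field_simp
    linear_combination (-3) * r2 - 3 * Ks * hmul
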